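/- Let $n,p$ be integers with $n-p-1>0$, let $M\in\mathbb{R}^{n\times p}$, and let $X\in\mathbb{R}^{n\times p}$ be a random matrix whose entries are independent Gaussian random variables $X_{ij}\sim \mathrm{N}(M_{ij},1)$. Let $\hat M_{\mathrm{EM}}=X\bigl(I_p-(n-p-1)(X^\top X)^{-1}\bigr)$ be the Efron--Morris estimator of $M$ (the matrix $X^\top X$ is almost surely invertible), and let $\hat M_{C_*}=XC_*$ be the linear oracle, where $C_*=C_*(M)=(M^\top M+nI_p)^{-1}M^\top M$. Then, for every symmetric positive definite matrix $Q\in\mathbb{R}^{p\times p}$, the losses below have finite expectation and $$\mathrm{E}_M\bigl[\operatorname{tr}\bigl((\hat M_{\mathrm{EM}}-M)\,Q\,(\hat M_{\mathrm{EM}}-M)^\top\bigr)\bigr]\le \mathrm{E}_M\bigl[\operatorname{tr}\bigl((\hat M_{C_*}-M)\,Q\,(\hat M_{C_*}-M)^\top\bigr)\bigr]+2(p+1)\operatorname{tr}(Q).$$ -/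

import Mathlib

open MeasureTheory ProbabilityTheory
open scoped Matrix

/-- `X` is a random `n × p` matrix on `(Ω, P)` whose entries are independent Gaussian random
variables `X i j ∼ N(M i j, 1)`. -/
structure IsGaussianMatrix {Ω : Type*} [MeasurableSpace Ω] {n p : ℕ}
    (X : Ω → Matrix (Fin n) (Fin p) ℝ) (M : Matrix (Fin n) (Fin p) ℝ) (P : Measure Ω) : Prop where
  hasLaw_entry : ∀ i j, HasLaw (fun ω => X ω i j) (gaussianReal (M i j) 1) P
  indep_entries : iIndepFun (fun (ij : Fin n × Fin p) (ω : Ω) => X ω ij.1 ij.2) P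

/-- The Efron–Morris estimator `X (I - (n - p - 1) (Xᵀ X)⁻¹)`. -/
noncomputable def efronMorris {n p : ℕ} (X : Matrix (Fin n) (Fin p) ℝ) :
    Matrix (Fin n) (Fin p) ℝ :=
  X * (1 - ((n : ℝ) - (p : ℝ) - 1) • (Xᵀ * X)⁻¹)

/-- The linear estimator `X C`. -/
def linearEstimator {n p : ℕ} (C : Matrix (Fin p) (Fin p) ℝ) (X : Matrix (Fin n) (Fin p) ℝ) :
    Matrix (Fin n) (Fin p) ℝ :=
  X * C

/-- The coefficient matrix `C_*(M) = (Mᵀ M + n I)⁻¹ Mᵀ M` of the linear oracle. -/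
noncomputable def oracleCoeff {n p : ℕ} (M : Matrix (Fin n) (Fin p) ℝ) :
    Matrix (Fin p) (Fin p) ℝ :=
  (Mᵀ * M + (n : ℝ) • (1 : Matrix (Fin p) (Fin p) ℝ))⁻¹ * (Mᵀ * M)

/-- The quadratic loss `tr ((M̂ - M) Q (M̂ - M)ᵀ)`. -/
def quadraticLoss {n p : ℕ} (Q : Matrix (Fin p) (Fin p) ℝ) (M Mhat : Matrix (Fin n) (Fin p) ℝ) :
    ℝ :=
  ((Mhat - M) * Q * (Mhat - M)ᵀ).trace

/-!
Write `c = n - p - 1` and `G_ε = (Xᵀ X + ε I)⁻¹`. Stein's identity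
`E tr ((X - M)ᵀ F(X)) = E (div F)(X)`, applied to the smooth field `F(X) = X G_ε Q`, whose
divergence is at least `c tr (Q G_ε)`, bounds the risk of `X (I - c G_ε)` by
`n tr Q - c² E tr (Q G_ε)`. For `Q = I` this risk being nonnegative bounds `E tr G_ε` uniformly in
`ε`, so `Xᵀ X` is almost surely invertible. Since `E (Xᵀ X) = Mᵀ M + n I`, Jensen's inequality for
`A ↦ A⁻¹` gives `E tr (Q G_ε) ≥ tr (Q (Mᵀ M + (n + ε) I)⁻¹)`, and letting `ε → 0` with Fatou's lemma
bounds the risk of the Efron–Morris estimator by `n tr Q - c² t`, where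
`t = tr (Q (Mᵀ M + n I)⁻¹)`. The oracle has risk exactly `n tr Q - n² t`, and the claim follows from
`n² - c² ≤ 2 n (p + 1)` and `n t ≤ tr Q`.
-/

open Filter Topology
open scoped ENNReal NNReal

section Stein

theorem hasDerivAt_gaussianPDFReal (m : ℝ) (v : ℝ≥0) (x : ℝ) :
    HasDerivAt (gaussianPDFReal m v) (-((x - m) / v) * gaussianPDFReal m v x) x := by
  have hexponent : HasDerivAt (fun y : ℝ => -(y - m) ^ 2 / (2 * v)) (-((x - m) / v)) x :=
    ((((hasDerivAt_id' x).sub_const m).pow 2).neg.div_const (2 * (v : ℝ))).congr_deriv (by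
      push_cast; ring)
  exact (hexponent.exp.const_mul (√(2 * Real.pi * v))⁻¹).congr_deriv (by
    rw [gaussianPDFReal]; ring)

theorem integrable_gaussianPDFReal_mul {m : ℝ} {v : ℝ≥0} (hv : v ≠ 0) {f : ℝ → ℝ}
    (hf : Integrable f (gaussianReal m v)) :
    Integrable (fun x => gaussianPDFReal m v x * f x) := by
  rw [gaussianReal_of_var_ne_zero _ hv,
    integrable_withDensity_iff_integrable_smul' (measurable_gaussianPDF m v)
      (ae_of_all _ fun _ => gaussianPDF_lt_top)] at hf
  simpa only [toReal_gaussianPDF, smul_eq_mul] using hf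

theorem integral_sub_mul_gaussianReal {m : ℝ} {v : ℝ≥0} {f f' : ℝ → ℝ}
    (hderiv : ∀ x, HasDerivAt f (f' x) x) (hf : Integrable f (gaussianReal m v))
    (hmul : Integrable (fun x => (x - m) * f x) (gaussianReal m v))
    (hf' : Integrable f' (gaussianReal m v)) :
    ∫ x, (x - m) * f x ∂gaussianReal m v = v * ∫ x, f' x ∂gaussianReal m v := by
  rcases eq_or_ne v 0 with rfl | hv
  · simp
  have hdensity (x : ℝ) : -((x - m) / v) * gaussianPDFReal m v x * f x
      = -(v : ℝ)⁻¹ * (gaussianPDFReal m v x * ((x - m) * f x)) := by ring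
  have hparts := integral_mul_deriv_eq_deriv_mul_of_integrable
    (fun x _ => hasDerivAt_gaussianPDFReal m v x) (fun x _ => hderiv x)
    (integrable_gaussianPDFReal_mul hv hf')
    (((integrable_gaussianPDFReal_mul hv hmul).const_mul _).congr
      (ae_of_all _ fun x => (hdensity x).symm))
    (integrable_gaussianPDFReal_mul hv hf)
  simp only [hdensity, integral_const_mul] at hparts
  rw [integral_gaussianReal_eq_integral_smul hv, integral_gaussianReal_eq_integral_smul hv]
  simp only [smul_eq_mul]
  rw [hparts]
  field_simp

theorem measurePreserving_update {ι : Type*} [Fintype ι] [DecidableEq ι] {α : ι → Type*}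
    [∀ i, MeasurableSpace (α i)] (μ : ∀ i, Measure (α i)) [∀ i, IsProbabilityMeasure (μ i)]
    (i : ι) :
    MeasurePreserving (fun z : (∀ j, α j) × α i => Function.update z.1 i z.2)
      ((Measure.pi μ).prod (μ i)) (Measure.pi μ) := by
  have hmeas : Measurable (fun z : (∀ j, α j) × α i => Function.update z.1 i z.2) := by
    refine measurable_pi_lambda _ fun j => ?_
    rcases eq_or_ne j i with rfl | hj
    · simpa only [Function.update_self] using measurable_snd
    · simp only [Function.update_of_ne hj]
      fun_prop
  refine ⟨hmeas, (Measure.pi_eq fun s hs => ?_).symm⟩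
  have hpreimage : (fun z : (∀ j, α j) × α i => Function.update z.1 i z.2) ⁻¹' Set.univ.pi s =
      Set.univ.pi (Function.update s i Set.univ) ×ˢ s i := by
    ext ⟨x, y⟩
    simp only [Set.mem_preimage, Set.mem_univ_pi, Set.mem_prod,
      Function.forall_update_iff x (fun j a => a ∈ s j),
      Function.forall_update_iff s (fun j t => x j ∈ t), Set.mem_univ, true_and]
    exact and_comm
  rw [Measure.map_apply hmeas (MeasurableSet.univ_pi hs), hpreimage, Measure.prod_prod,
    Measure.pi_pi, ← Finset.mul_prod_erase _ _ (Finset.mem_univ i),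
    ← Finset.mul_prod_erase _ (fun j => μ j (s j)) (Finset.mem_univ i), Function.update_self,
    measure_univ, one_mul, mul_comm]
  congr 1
  exact Finset.prod_congr rfl fun j hj => by
    rw [Function.update_of_ne (Finset.ne_of_mem_erase hj)]

theorem hasDerivAt_update_of_hasLineDerivAt {ι : Type*} [DecidableEq ι] {f : (ι → ℝ) → ℝ} {f' : ℝ}
    {x : ι → ℝ} {i : ι} (h : HasLineDerivAt ℝ f f' x (Pi.single i 1)) :
    HasDerivAt (fun t => f (Function.update x i t)) f' (x i) := by
  have hshift : HasDerivAt (fun t => f (x + (t - x i) • Pi.single i 1)) f' (x i) := by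
    have h0 : HasDerivAt (fun t : ℝ => f (x + t • Pi.single i 1)) f' (x i - x i) := by
      rw [sub_self]; exact h
    exact h0.comp_sub_const (x i) (x i)
  refine hshift.congr_of_eventuallyEq (Eventually.of_forall fun t => congrArg f ?_)
  ext j
  rcases eq_or_ne j i with rfl | hj
  · simp
  · simp [hj]

theorem integral_sub_mul_pi_gaussianReal {ι : Type*} [Fintype ι] [DecidableEq ι] {m : ι → ℝ}
    {v : ι → ℝ≥0} (i : ι) {f f' : (ι → ℝ) → ℝ}
    (hderiv : ∀ x, HasLineDerivAt ℝ f (f' x) x (Pi.single i 1))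
    (hf : Integrable f (Measure.pi fun j => gaussianReal (m j) (v j)))
    (hmul : Integrable (fun x => (x i - m i) * f x)
      (Measure.pi fun j => gaussianReal (m j) (v j)))
    (hf' : Integrable f' (Measure.pi fun j => gaussianReal (m j) (v j))) :
    ∫ x, (x i - m i) * f x ∂Measure.pi (fun j => gaussianReal (m j) (v j)) =
      v i * ∫ x, f' x ∂Measure.pi (fun j => gaussianReal (m j) (v j)) := by
  have hupdate := measurePreserving_update (fun j => gaussianReal (m j) (v j)) i
  have integrable_update {g : (ι → ℝ) → ℝ}
      (hg : Integrable g (Measure.pi fun j => gaussianReal (m j) (v j))) :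
      Integrable (fun z : (ι → ℝ) × ℝ => g (Function.update z.1 i z.2))
        ((Measure.pi fun j => gaussianReal (m j) (v j)).prod (gaussianReal (m i) (v i))) :=
    hupdate.integrable_comp_of_integrable hg
  have integral_resample {g : (ι → ℝ) → ℝ}
      (hg : Integrable g (Measure.pi fun j => gaussianReal (m j) (v j))) :
      ∫ x, g x ∂Measure.pi (fun j => gaussianReal (m j) (v j)) =
        ∫ x, ∫ t, g (Function.update x i t) ∂gaussianReal (m i) (v i)
          ∂Measure.pi (fun j => gaussianReal (m j) (v j)) := by
    rw [← integral_prod _ (integrable_update hg), ← integral_map hupdate.aemeasurable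
      (by rw [hupdate.map_eq]; exact hg.1), hupdate.map_eq]
  rw [integral_resample hmul, integral_resample hf', ← integral_const_mul]
  refine integral_congr_ae ?_
  filter_upwards [(integrable_update hf).prod_right_ae, (integrable_update hmul).prod_right_ae,
    (integrable_update hf').prod_right_ae] with x hfx hmulx hf'x
  simp only [Function.update_self] at hmulx ⊢
  refine integral_sub_mul_gaussianReal (fun t => ?_) hfx hmulx hf'x
  simpa only [Function.update_idem, Function.update_self] using
    hasDerivAt_update_of_hasLineDerivAt (hderiv (Function.update x i t))

end Stein

section PosSemidef

theorem transpose_eq_self_of_posSemidef {k : Type*} {A : Matrix k k ℝ} (hA : A.PosSemidef) :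
    Aᵀ = A := by
  simpa only [Matrix.IsHermitian, Matrix.conjTranspose_eq_transpose_of_trivial] using
    hA.isHermitian

theorem abs_apply_le_of_posSemidef {k : Type*} {A : Matrix k k ℝ} (hA : A.PosSemidef) (i j : k) :
    |A i j| ≤ (A i i + A j j) / 2 := by
  have hsymm : A j i = A i j := congrFun₂ (transpose_eq_self_of_posSemidef hA) i j
  have hform (s : ℝ) := (hA.submatrix ![i, j]).dotProduct_mulVec_nonneg ![1, s]
  have hadd := hform 1
  have hsub := hform (-1)
  simp only [dotProduct, Nat.succ_eq_add_one, Nat.reduceAdd, Pi.star_apply, star_trivial,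
    Matrix.mulVec, Matrix.submatrix_apply, Fin.sum_univ_two, Fin.isValue, Matrix.cons_val_zero,
    mul_one, Matrix.cons_val_one, Matrix.cons_val_fin_one, one_mul, hsymm, mul_neg, neg_mul,
    neg_add_rev, neg_neg] at hadd hsub
  rw [abs_le]
  constructor <;> linarith

theorem posSemidef_gram {m k : Type*} [Fintype m] [Finite k] (X : Matrix m k ℝ) :
    (Xᵀ * X).PosSemidef := by
  simpa only [Matrix.conjTranspose_eq_transpose_of_trivial] using
    Matrix.posSemidef_conjTranspose_mul_self X

theorem posDef_gram_add_smul_one {m k : Type*} [Fintype m] [Finite k] [DecidableEq k] {ε : ℝ}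
    (hε : 0 < ε) (X : Matrix m k ℝ) : (Xᵀ * X + ε • (1 : Matrix k k ℝ)).PosDef :=
  (Matrix.PosDef.one.smul hε).posSemidef_add (posSemidef_gram X)

variable {k : Type*} [Fintype k]

open scoped MatrixOrder in
theorem trace_mul_nonneg_of_posSemidef {A B : Matrix k k ℝ} (hA : A.PosSemidef)
    (hB : B.PosSemidef) : 0 ≤ (A * B).trace := by
  classical
  obtain ⟨C, rfl⟩ := CStarAlgebra.nonneg_iff_eq_star_mul_self.1 hB.nonneg
  rw [Matrix.star_eq_conjTranspose, ← Matrix.mul_assoc, Matrix.trace_mul_comm, ← Matrix.mul_assoc]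
  exact (hA.mul_mul_conjTranspose_same C).trace_nonneg

theorem le_trace_of_mem_spectrum [DecidableEq k] {A : Matrix k k ℝ} (hA : A.PosSemidef) {a : ℝ}
    (ha : a ∈ spectrum ℝ A) : a ≤ A.trace := by
  rw [hA.isHermitian.spectrum_real_eq_range_eigenvalues] at ha
  obtain ⟨i, rfl⟩ := ha
  rw [hA.isHermitian.trace_eq_sum_eigenvalues]
  exact Finset.single_le_sum (fun j _ => hA.eigenvalues_nonneg j) (Finset.mem_univ i)

/- The difference is `(A⁻¹ - B) A (A⁻¹ - B)`; equality holds at `B = A⁻¹`, so this is the tangent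
bound for the convex function `A ↦ A⁻¹`. -/
theorem posSemidef_inv_sub_tangent [DecidableEq k] {A B : Matrix k k ℝ} (hA : A.PosDef)
    (hB : Bᵀ = B) : (A⁻¹ - ((2 : ℝ) • B - B * A * B)).PosSemidef := by
  have hunit : IsUnit A.det := (Matrix.isUnit_iff_isUnit_det _).1 hA.isUnit
  have hsymm : (A⁻¹ - B)ᵀ = A⁻¹ - B := by
    rw [Matrix.transpose_sub, hB, transpose_eq_self_of_posSemidef hA.inv.posSemidef]
  have hsq := hA.posSemidef.conjTranspose_mul_mul_same (A⁻¹ - B)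
  rw [Matrix.conjTranspose_eq_transpose_of_trivial, hsymm] at hsq
  convert hsq using 1
  simp only [Matrix.sub_mul, Matrix.mul_sub, Matrix.nonsing_inv_mul _ hunit, Matrix.mul_assoc,
    Matrix.mul_nonsing_inv _ hunit, Matrix.one_mul, Matrix.mul_one, two_smul]
  abel

end PosSemidef

section RidgeInverse

variable {m k : Type*} [Fintype m] [Fintype k] [DecidableEq k]

/-- The regularized inverse Gram matrix `(Xᵀ X + ε I)⁻¹`; at `ε = 0` it is the inverse Gram matrix
itself, with Mathlib's value `0` when `Xᵀ X` is singular. -/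
noncomputable def ridgeInv (ε : ℝ) (X : Matrix m k ℝ) : Matrix k k ℝ :=
  (Xᵀ * X + ε • (1 : Matrix k k ℝ))⁻¹

theorem ridgeInv_zero (X : Matrix m k ℝ) : ridgeInv 0 X = (Xᵀ * X)⁻¹ := by
  rw [ridgeInv, zero_smul, add_zero]

variable {ε : ℝ}

theorem isUnit_gram_add_smul_one (hε : 0 < ε) (X : Matrix m k ℝ) :
    IsUnit (Xᵀ * X + ε • (1 : Matrix k k ℝ)) :=
  (posDef_gram_add_smul_one hε X).isUnit

theorem posSemidef_ridgeInv (hε : 0 < ε) (X : Matrix m k ℝ) : (ridgeInv ε X).PosSemidef :=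
  (posDef_gram_add_smul_one hε X).inv.posSemidef

theorem transpose_ridgeInv (hε : 0 < ε) (X : Matrix m k ℝ) : (ridgeInv ε X)ᵀ = ridgeInv ε X :=
  transpose_eq_self_of_posSemidef (posSemidef_ridgeInv hε X)

theorem gram_mul_ridgeInv (hε : 0 < ε) (X : Matrix m k ℝ) :
    Xᵀ * X * ridgeInv ε X = 1 - ε • ridgeInv ε X := by
  have hinv := Matrix.mul_nonsing_inv _
    ((Matrix.isUnit_iff_isUnit_det _).1 (isUnit_gram_add_smul_one hε X))
  rw [← ridgeInv, Matrix.add_mul, Matrix.smul_mul, Matrix.one_mul] at hinv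
  exact eq_sub_of_add_eq hinv

theorem ridgeInv_mul_gram (hε : 0 < ε) (X : Matrix m k ℝ) :
    ridgeInv ε X * (Xᵀ * X) = 1 - ε • ridgeInv ε X := by
  have hinv := Matrix.nonsing_inv_mul _
    ((Matrix.isUnit_iff_isUnit_det _).1 (isUnit_gram_add_smul_one hε X))
  rw [← ridgeInv, Matrix.mul_add, Matrix.mul_smul, Matrix.mul_one] at hinv
  exact eq_sub_of_add_eq hinv

theorem transpose_mul_self_mul_ridgeInv (hε : 0 < ε) (X : Matrix m k ℝ) :
    (X * ridgeInv ε X)ᵀ * (X * ridgeInv ε X) =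
      ridgeInv ε X - ε • (ridgeInv ε X * ridgeInv ε X) := by
  rw [Matrix.transpose_mul, transpose_ridgeInv hε, Matrix.mul_assoc, ← Matrix.mul_assoc Xᵀ,
    gram_mul_ridgeInv hε, Matrix.mul_sub, Matrix.mul_one, Matrix.mul_smul]

theorem posSemidef_one_sub_smul_ridgeInv (hε : 0 < ε) (X : Matrix m k ℝ) :
    (1 - ε • ridgeInv ε X).PosSemidef := by
  have hsum := (posSemidef_gram (Xᵀ * X * ridgeInv ε X)).add
    ((posSemidef_gram (X * ridgeInv ε X)).smul hε.le)
  convert hsum using 1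
  rw [transpose_mul_self_mul_ridgeInv hε, gram_mul_ridgeInv hε, Matrix.transpose_sub,
    Matrix.transpose_smul, transpose_ridgeInv hε, Matrix.transpose_one]
  simp only [Matrix.sub_mul, Matrix.mul_sub, Matrix.one_mul, Matrix.mul_one, Matrix.smul_mul,
    Matrix.mul_smul, smul_sub]
  abel

theorem abs_ridgeInv_apply_le (hε : 0 < ε) (X : Matrix m k ℝ) (i j : k) :
    |ridgeInv ε X i j| ≤ ε⁻¹ := by
  have hdiag (l : k) : ridgeInv ε X l l ≤ ε⁻¹ := by
    have h := (posSemidef_one_sub_smul_ridgeInv hε X).diag_nonneg (i := l)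
    rw [Matrix.sub_apply, Matrix.one_apply_eq, Matrix.smul_apply, smul_eq_mul, sub_nonneg] at h
    rwa [← one_div, le_div_iff₀' hε]
  have hentry := abs_apply_le_of_posSemidef (posSemidef_ridgeInv hε X) i j
  linarith [hdiag i, hdiag j]

theorem inv_le_trace_ridgeInv (hε : 0 < ε) {X : Matrix m k ℝ} (hX : ¬IsUnit (Xᵀ * X)) :
    ε⁻¹ ≤ (ridgeInv ε X).trace := by
  refine le_trace_of_mem_spectrum (posSemidef_ridgeInv hε X) ?_
  have hresolvent : algebraMap ℝ (Matrix k k ℝ) ε⁻¹ - ridgeInv ε X =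
      ε⁻¹ • (ridgeInv ε X * (Xᵀ * X)) := by
    rw [ridgeInv_mul_gram hε, smul_sub, inv_smul_smul₀ hε.ne', Algebra.algebraMap_eq_smul_one]
  rw [spectrum.mem_iff, hresolvent]
  rw [Matrix.isUnit_iff_isUnit_det, isUnit_iff_ne_zero] at hX ⊢
  rw [not_not] at hX
  rw [Matrix.det_smul, Matrix.det_mul, hX, mul_zero, mul_zero]
  exact not_not.2 rfl

theorem trace_mul_ridgeInv_nonneg (hε : 0 < ε) {Q : Matrix k k ℝ} (hQ : Q.PosSemidef)
    (X : Matrix m k ℝ) : 0 ≤ (Q * ridgeInv ε X).trace :=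
  trace_mul_nonneg_of_posSemidef hQ (posSemidef_ridgeInv hε X)

theorem trace_ridgeInv_mul_mul_ridgeInv_nonneg (hε : 0 < ε) {Q : Matrix k k ℝ}
    (hQ : Q.PosSemidef) (X : Matrix m k ℝ) : 0 ≤ (ridgeInv ε X * Q * ridgeInv ε X).trace := by
  have h := (hQ.mul_mul_conjTranspose_same (ridgeInv ε X)).trace_nonneg
  rwa [(posSemidef_ridgeInv hε X).isHermitian.eq] at h

theorem trace_mul_ridgeInv_mul_transpose (hε : 0 < ε) (Q : Matrix k k ℝ) (X : Matrix m k ℝ) :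
    (X * ridgeInv ε X * Q * (X * ridgeInv ε X)ᵀ).trace =
      (Q * ridgeInv ε X).trace - ε * (ridgeInv ε X * Q * ridgeInv ε X).trace := by
  rw [Matrix.mul_assoc, Matrix.trace_mul_comm, Matrix.mul_assoc,
    transpose_mul_self_mul_ridgeInv hε, Matrix.mul_sub, Matrix.trace_sub, Matrix.mul_smul,
    Matrix.trace_smul, smul_eq_mul, ← Matrix.mul_assoc,
    Matrix.trace_mul_comm (_ * _) (ridgeInv ε X), Matrix.mul_assoc (ridgeInv ε X)]

theorem trace_mul_ridgeInv_mul_transpose_le (hε : 0 < ε) {Q : Matrix k k ℝ} (hQ : Q.PosSemidef)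
    (X : Matrix m k ℝ) :
    (X * ridgeInv ε X * Q * (X * ridgeInv ε X)ᵀ).trace ≤ (Q * ridgeInv ε X).trace := by
  rw [trace_mul_ridgeInv_mul_transpose hε]
  exact sub_le_self _ (mul_nonneg hε.le (trace_ridgeInv_mul_mul_ridgeInv_nonneg hε hQ X))

theorem mul_trace_mul_ridgeInv_le_trace (hε : 0 < ε) {Q : Matrix k k ℝ} (hQ : Q.PosSemidef)
    (X : Matrix m k ℝ) : ε * (Q * ridgeInv ε X).trace ≤ Q.trace := by
  have h := trace_mul_nonneg_of_posSemidef hQ (posSemidef_one_sub_smul_ridgeInv hε X)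
  rwa [Matrix.mul_sub, Matrix.mul_one, Matrix.mul_smul, Matrix.trace_sub, Matrix.trace_smul,
    smul_eq_mul, sub_nonneg] at h

theorem continuousAt_inv_of_isUnit {A : Matrix k k ℝ} (hA : IsUnit A) :
    ContinuousAt Inv.inv A :=
  continuousAt_matrix_inv A (by
    rw [Ring.inverse_eq_inv']
    exact continuousAt_inv₀ ((Matrix.isUnit_iff_isUnit_det _).1 hA).ne_zero)

theorem continuous_ridgeInv (hε : 0 < ε) : Continuous (ridgeInv ε : Matrix m k ℝ → _) :=
  continuous_iff_continuousAt.2 fun X =>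
    (continuousAt_inv_of_isUnit (isUnit_gram_add_smul_one hε X)).comp
      (f := fun Y : Matrix m k ℝ => Yᵀ * Y + ε • (1 : Matrix k k ℝ)) (by fun_prop)

theorem continuousAt_ridgeInv_left {X : Matrix m k ℝ}
    (hX : IsUnit (Xᵀ * X + ε • (1 : Matrix k k ℝ))) : ContinuousAt (fun δ => ridgeInv δ X) ε :=
  (continuousAt_inv_of_isUnit hX).comp
    (f := fun δ : ℝ => Xᵀ * X + δ • (1 : Matrix k k ℝ)) (by fun_prop)

end RidgeInverse

section Divergence

variable {m k l : Type*} [Fintype m] [Fintype k] [DecidableEq k] {ε : ℝ}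

theorem hasLineDerivAt_of_eq_add_mul {E : Type*} [AddCommGroup E] [Module ℝ E] {f : E → ℝ}
    {x v : E} {r : ℝ → ℝ} (hr : ContinuousAt r 0) (h : ∀ t : ℝ, f (x + t • v) = f x + t * r t) :
    HasLineDerivAt ℝ f (r 0) x v := by
  rw [HasLineDerivAt, hasDerivAt_iff_tendsto_slope]
  refine (hr.tendsto.mono_left nhdsWithin_le_nhds).congr' ?_
  filter_upwards [self_mem_nhdsWithin] with t ht
  rw [slope_def_field, h t, h 0]
  field_simp [Set.mem_compl_singleton_iff.1 ht]
  ring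

theorem ridgeInv_sub_ridgeInv (hε : 0 < ε) (X Y : Matrix m k ℝ) :
    ridgeInv ε Y - ridgeInv ε X = -(ridgeInv ε Y * (Yᵀ * Y - Xᵀ * X) * ridgeInv ε X) := by
  rw [Matrix.mul_sub, ridgeInv_mul_gram hε, Matrix.sub_mul, Matrix.mul_assoc, gram_mul_ridgeInv hε]
  simp only [Matrix.sub_mul, Matrix.mul_sub, Matrix.one_mul, Matrix.mul_one, Matrix.smul_mul,
    Matrix.mul_smul]
  abel

theorem add_smul_mul_ridgeInv (hε : 0 < ε) (X E : Matrix m k ℝ) (t : ℝ) :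
    (X + t • E) * ridgeInv ε (X + t • E) = X * ridgeInv ε X + t •
      (E * ridgeInv ε (X + t • E)
        - X * ridgeInv ε (X + t • E) * (Eᵀ * X + Xᵀ * E + t • (Eᵀ * E)) * ridgeInv ε X) := by
  have hgram : (X + t • E)ᵀ * (X + t • E) - Xᵀ * X =
      t • (Eᵀ * X + Xᵀ * E + t • (Eᵀ * E)) := by
    simp only [Matrix.transpose_add, Matrix.transpose_smul, Matrix.add_mul, Matrix.mul_add,
      Matrix.smul_mul, Matrix.mul_smul, smul_add]
    abel
  have hdiff := ridgeInv_sub_ridgeInv hε X (X + t • E)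
  rw [hgram, sub_eq_iff_eq_add] at hdiff
  have hmul := congrArg (X * ·) hdiff
  simp only [Matrix.mul_smul, Matrix.smul_mul, Matrix.mul_add X, Matrix.mul_neg,
    ← Matrix.mul_assoc X] at hmul
  rw [Matrix.add_mul, Matrix.smul_mul, smul_sub]
  linear_combination (norm := abel) hmul

theorem hasLineDerivAt_mul_ridgeInv_mul_apply (hε : 0 < ε) (Q : Matrix k l ℝ) (X E : Matrix m k ℝ)
    (i : m) (j : l) :
    HasLineDerivAt ℝ (fun Y : Matrix m k ℝ => (Y * ridgeInv ε Y * Q) i j)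
      (((E - X * ridgeInv ε X * (Eᵀ * X + Xᵀ * E)) * ridgeInv ε X * Q) i j) X E := by
  let r (t : ℝ) : ℝ := ((E * ridgeInv ε (X + t • E)
    - X * ridgeInv ε (X + t • E) * (Eᵀ * X + Xᵀ * E + t • (Eᵀ * E)) * ridgeInv ε X) * Q) i j
  have hr : Continuous r := by
    have hG : Continuous fun t : ℝ => ridgeInv ε (X + t • E) :=
      (continuous_ridgeInv hε).comp (by fun_prop)
    fun_prop
  have hexpand (t : ℝ) : ((X + t • E) * ridgeInv ε (X + t • E) * Q) i j =
      (X * ridgeInv ε X * Q) i j + t * r t := by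
    rw [add_smul_mul_ridgeInv hε, Matrix.add_mul, Matrix.smul_mul, Matrix.add_apply,
      Matrix.smul_apply, smul_eq_mul]
  have hderiv := hasLineDerivAt_of_eq_add_mul
    (f := fun Y : Matrix m k ℝ => (Y * ridgeInv ε Y * Q) i j) hr.continuousAt hexpand
  simpa only [r, zero_smul, add_zero, Matrix.sub_mul] using hderiv

/-- The matrix of partial derivatives `∂(X (Xᵀ X + ε I)⁻¹ Q) i j / ∂X i j`, whose entries sum to the
divergence of the vector field `X ↦ X (Xᵀ X + ε I)⁻¹ Q`. -/
noncomputable def ridgeEntryDeriv (ε : ℝ) (Q : Matrix k k ℝ) (X : Matrix m k ℝ) : Matrix m k ℝ :=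
  Matrix.of fun i j => (ridgeInv ε X * Q) j j
    - (X * ridgeInv ε X) i j * (X * ridgeInv ε X * Q) i j
    - (X * ridgeInv ε X * Xᵀ) i i * (ridgeInv ε X * Q) j j

theorem continuous_ridgeEntryDeriv (hε : 0 < ε) (Q : Matrix k k ℝ) :
    Continuous (ridgeEntryDeriv ε Q : Matrix m k ℝ → _) := by
  have hG := continuous_ridgeInv (m := m) (k := k) hε
  unfold ridgeEntryDeriv
  fun_prop

theorem mul_single_one_mul_apply {a b : Type*} [DecidableEq m] (A : Matrix a m ℝ)
    (B : Matrix k b ℝ) (i : m) (j : k) (i' : a) (j' : b) :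
    (A * Matrix.single i j (1 : ℝ) * B) i' j' = A i' i * B j j' := by
  simp [Matrix.mul_apply, Matrix.single_apply, ite_and]

theorem hasLineDerivAt_ridgeEntryDeriv [DecidableEq m] (hε : 0 < ε) (Q : Matrix k k ℝ)
    (X : Matrix m k ℝ) (i : m) (j : k) :
    HasLineDerivAt ℝ (fun Y : Matrix m k ℝ => (Y * ridgeInv ε Y * Q) i j)
      (ridgeEntryDeriv ε Q X i j) X (Matrix.single i j 1) := by
  convert hasLineDerivAt_mul_ridgeInv_mul_apply hε Q X (Matrix.single i j 1) i j using 1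
  set G := ridgeInv ε X
  have hdirect := mul_single_one_mul_apply (1 : Matrix m m ℝ) (G * Q) i j i j
  have hleft := mul_single_one_mul_apply (X * G) (X * G * Q) j i i j
  have hright := mul_single_one_mul_apply (X * G * Xᵀ) (G * Q) i j i j
  simp only [ridgeEntryDeriv, Matrix.of_apply, Matrix.transpose_single, Matrix.mul_add,
    Matrix.sub_mul, Matrix.add_mul, Matrix.sub_apply, Matrix.add_apply, Matrix.mul_assoc,
    Matrix.one_mul, Matrix.one_apply_eq, one_mul] at hdirect hleft hright ⊢
  rw [hdirect, hleft, hright]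
  ring

theorem sum_ridgeEntryDeriv (hε : 0 < ε) (Q : Matrix k k ℝ) (X : Matrix m k ℝ) :
    ∑ i, ∑ j, ridgeEntryDeriv ε Q X i j =
      ((Fintype.card m : ℝ) - Fintype.card k - 1) * (Q * ridgeInv ε X).trace
        + ε * ((ridgeInv ε X).trace * (Q * ridgeInv ε X).trace
          + (ridgeInv ε X * Q * ridgeInv ε X).trace) := by
  have hleverage : (X * ridgeInv ε X * Xᵀ).trace = Fintype.card k - ε * (ridgeInv ε X).trace := by
    rw [Matrix.trace_mul_comm, ← Matrix.mul_assoc, gram_mul_ridgeInv hε, Matrix.trace_sub,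
      Matrix.trace_one, Matrix.trace_smul, smul_eq_mul]
  have hshrink : ∑ i, ∑ j, (X * ridgeInv ε X) i j * (X * ridgeInv ε X * Q) i j =
      (Q * ridgeInv ε X).trace - ε * (ridgeInv ε X * Q * ridgeInv ε X).trace := by
    have htrace : ((X * ridgeInv ε X)ᵀ * (X * ridgeInv ε X) * Q).trace =
        (Q * ridgeInv ε X).trace - ε * (ridgeInv ε X * Q * ridgeInv ε X).trace := by
      rw [transpose_mul_self_mul_ridgeInv hε, Matrix.sub_mul, Matrix.trace_sub, Matrix.smul_mul,
        Matrix.trace_smul, smul_eq_mul, Matrix.trace_mul_comm, Matrix.mul_assoc,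
        Matrix.trace_mul_comm (ridgeInv ε X) (ridgeInv ε X * Q)]
    rw [← htrace, Matrix.mul_assoc ((X * ridgeInv ε X)ᵀ), Finset.sum_comm]
    rfl
  have hdiag : ∑ j, (ridgeInv ε X * Q) j j = (Q * ridgeInv ε X).trace :=
    Matrix.trace_mul_comm _ _
  have hsum : ∑ i, ∑ j, ridgeEntryDeriv ε Q X i j =
      Fintype.card m * ∑ j, (ridgeInv ε X * Q) j j
      - ∑ i, ∑ j, (X * ridgeInv ε X) i j * (X * ridgeInv ε X * Q) i j
      - (X * ridgeInv ε X * Xᵀ).trace * ∑ j, (ridgeInv ε X * Q) j j := by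
    simp only [ridgeEntryDeriv, Matrix.of_apply, Finset.sum_sub_distrib, Finset.sum_const,
      Finset.card_univ, nsmul_eq_mul, ← Finset.mul_sum, ← Finset.sum_mul]
    rfl
  rw [hsum, hleverage, hshrink, hdiag]
  ring

theorem trace_mul_ridgeInv_le_divergence (hε : 0 < ε) {Q : Matrix k k ℝ} (hQ : Q.PosSemidef)
    (X : Matrix m k ℝ) :
    ((Fintype.card m : ℝ) - Fintype.card k - 1) * (Q * ridgeInv ε X).trace ≤
      ∑ i, ∑ j, ridgeEntryDeriv ε Q X i j := by
  have hG := (posSemidef_ridgeInv hε X).trace_nonneg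
  have hQG := trace_mul_ridgeInv_nonneg hε hQ X
  have hGQG := trace_ridgeInv_mul_mul_ridgeInv_nonneg hε hQ X
  rw [sum_ridgeEntryDeriv hε]
  exact le_add_of_nonneg_right (by positivity)

end Divergence

section EntrywiseMemLp

variable {Ω m k l : Type*} [MeasurableSpace Ω]

/-- The entries of the random matrix `A` all lie in `L^q`; this is how moments of a random matrix
are expressed here, as `Matrix` carries no canonical norm. -/
def EntrywiseMemLp (A : Ω → Matrix m k ℝ) (q : ℝ≥0∞) (P : Measure Ω) : Prop :=
  ∀ i j, MemLp (fun ω => A ω i j) q P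

namespace EntrywiseMemLp

variable {P : Measure Ω} {q r s : ℝ≥0∞} {A : Ω → Matrix m k ℝ}

theorem add {B : Ω → Matrix m k ℝ} (hA : EntrywiseMemLp A q P) (hB : EntrywiseMemLp B q P) :
    EntrywiseMemLp (fun ω => A ω + B ω) q P :=
  fun i j => (hA i j).add (hB i j)

theorem sub {B : Ω → Matrix m k ℝ} (hA : EntrywiseMemLp A q P) (hB : EntrywiseMemLp B q P) :
    EntrywiseMemLp (fun ω => A ω - B ω) q P :=
  fun i j => (hA i j).sub (hB i j)

theorem const_smul (hA : EntrywiseMemLp A q P) (c : ℝ) :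
    EntrywiseMemLp (fun ω => c • A ω) q P :=
  fun i j => (hA i j).const_smul c

theorem transpose (hA : EntrywiseMemLp A q P) : EntrywiseMemLp (fun ω => (A ω)ᵀ) q P :=
  fun i j => hA j i

theorem const [IsFiniteMeasure P] (C : Matrix m k ℝ) : EntrywiseMemLp (fun _ => C) q P :=
  fun _ _ => memLp_const _

theorem mul [Fintype k] [ENNReal.HolderTriple q r s] {B : Ω → Matrix k l ℝ}
    (hA : EntrywiseMemLp A q P) (hB : EntrywiseMemLp B r P) :
    EntrywiseMemLp (fun ω => A ω * B ω) s P :=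
  fun i j => memLp_finsetSum _ fun a _ => (hB a j).mul' (hA i a)

theorem mul_const [Fintype k] (hA : EntrywiseMemLp A q P) (C : Matrix k l ℝ) :
    EntrywiseMemLp (fun ω => A ω * C) q P :=
  fun i j => memLp_finsetSum _ fun a _ => (hA i a).mul_const (C a j)

theorem integrable_trace {A : Ω → Matrix k k ℝ} [Fintype k] (hA : EntrywiseMemLp A 1 P) :
    Integrable (fun ω => (A ω).trace) P :=
  integrable_finsetSum _ fun i _ => memLp_one_iff_integrable.1 (hA i i)

theorem integrable_trace_transpose_mul [Fintype m] [Fintype k] {B : Ω → Matrix m k ℝ}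
    (hA : EntrywiseMemLp A 2 P) (hB : EntrywiseMemLp B 2 P) :
    Integrable (fun ω => ((A ω)ᵀ * B ω).trace) P :=
  (hA.transpose.mul hB).integrable_trace

theorem integrable_quadraticLoss [IsFiniteMeasure P] {n p : ℕ} {A : Ω → Matrix (Fin n) (Fin p) ℝ}
    (hA : EntrywiseMemLp A 2 P) (Q : Matrix (Fin p) (Fin p) ℝ) (T : Matrix (Fin n) (Fin p) ℝ) :
    Integrable (fun ω => quadraticLoss Q T (A ω)) P :=
  have hdiff : EntrywiseMemLp (fun ω => A ω - T) 2 P := hA.sub (.const T)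
  ((hdiff.mul_const Q).mul (s := 1) hdiff.transpose).integrable_trace

end EntrywiseMemLp

end EntrywiseMemLp

namespace IsGaussianMatrix

variable {Ω : Type*} [MeasurableSpace Ω] {P : Measure Ω} {n p : ℕ}
  {X : Ω → Matrix (Fin n) (Fin p) ℝ} {M : Matrix (Fin n) (Fin p) ℝ}

theorem entrywiseMemLp (hX : IsGaussianMatrix X M P) {q : ℝ≥0∞} (hq : q ≠ ∞) :
    EntrywiseMemLp X q P := by
  intro i j
  lift q to ℝ≥0 using hq
  have hlaw := hX.hasLaw_entry i j
  have hid : MemLp id (q : ℝ≥0∞) (Measure.map (fun ω => X ω i j) P) :=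
    hlaw.map_eq ▸ memLp_id_gaussianReal q
  exact hid.comp_of_map hlaw.aemeasurable

theorem hasLaw_uncurry (hX : IsGaussianMatrix X M P) :
    HasLaw (fun ω (ij : Fin n × Fin p) => X ω ij.1 ij.2)
      (Measure.pi fun ij : Fin n × Fin p => gaussianReal (M ij.1 ij.2) 1) P :=
  hX.indep_entries.hasLaw_pi fun ij => hX.hasLaw_entry ij.1 ij.2

theorem aestronglyMeasurable_comp (hX : IsGaussianMatrix X M P)
    {f : Matrix (Fin n) (Fin p) ℝ → ℝ} (hf : Continuous f) :
    AEStronglyMeasurable (fun ω => f (X ω)) P := by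
  have hcont : Continuous fun x : Fin n × Fin p → ℝ => f (Matrix.of fun i j => x (i, j)) :=
    hf.comp (continuous_matrix fun i j => continuous_apply _)
  exact (hcont.measurable.comp_aemeasurable hX.hasLaw_uncurry.aemeasurable).aestronglyMeasurable

variable [IsProbabilityMeasure P]

theorem integral_sub_mul (hX : IsGaussianMatrix X M P) (i : Fin n) (j : Fin p)
    {f f' : Matrix (Fin n) (Fin p) ℝ → ℝ} (hf : Continuous f) (hf' : Continuous f')
    (hderiv : ∀ Y, HasLineDerivAt ℝ f (f' Y) Y (Matrix.single i j 1))
    (hf_mem : MemLp (fun ω => f (X ω)) 2 P) (hf'_int : Integrable (fun ω => f' (X ω)) P) :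
    ∫ ω, (X ω i j - M i j) * f (X ω) ∂P = ∫ ω, f' (X ω) ∂P := by
  let L : (Fin n × Fin p → ℝ) →ₗ[ℝ] Matrix (Fin n) (Fin p) ℝ :=
    { toFun := fun x => Matrix.of fun a b => x (a, b)
      map_add' := fun _ _ => rfl
      map_smul' := fun _ _ => rfl }
  have hL : Continuous L := continuous_matrix fun a b => continuous_apply (a, b)
  have hLsingle : L (Pi.single (i, j) 1) = Matrix.single i j 1 := by
    ext a b
    change (Pi.single (i, j) 1 : Fin n × Fin p → ℝ) (a, b) = _
    simp only [Pi.single_apply, Matrix.single_apply, Prod.mk.injEq, eq_comm]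
  have hderivL (x : Fin n × Fin p → ℝ) :
      HasLineDerivAt ℝ (f ∘ L) (f' (L x)) x (Pi.single (i, j) 1) := by
    have h := hderiv (L x)
    rw [← hLsingle] at h
    simpa only [HasLineDerivAt, Function.comp_apply, map_add, map_smul] using h
  have hlaw := hX.hasLaw_uncurry
  have integrable_law {g : Matrix (Fin n) (Fin p) ℝ → ℝ} (hg : Continuous g)
      (hint : Integrable (fun ω => g (X ω)) P) :
      Integrable (g ∘ L) (Measure.pi fun ij : Fin n × Fin p => gaussianReal (M ij.1 ij.2) 1) := by
    rw [← hlaw.map_eq]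
    exact (integrable_map_measure (hg.comp hL).aestronglyMeasurable hlaw.aemeasurable).2 hint
  have hmul : Continuous fun Y : Matrix (Fin n) (Fin p) ℝ => (Y i j - M i j) * f Y := by fun_prop
  have hcentered : MemLp (fun ω => X ω i j - M i j) 2 P :=
    (hX.entrywiseMemLp (by simp) i j).sub (memLp_const _)
  have hstein := integral_sub_mul_pi_gaussianReal (i, j) hderivL
    (integrable_law hf (hf_mem.integrable (by norm_num)))
    (integrable_law hmul (hcentered.integrable_mul hf_mem)) (integrable_law hf' hf'_int)
  rw [NNReal.coe_one, one_mul] at hstein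
  exact (hlaw.integral_comp (hmul.comp hL).aestronglyMeasurable).trans <|
    hstein.trans (hlaw.integral_comp (hf'.comp hL).aestronglyMeasurable).symm

theorem integral_trace_sub_transpose_mul (hX : IsGaussianMatrix X M P)
    {F D : Matrix (Fin n) (Fin p) ℝ → Matrix (Fin n) (Fin p) ℝ} (hF : Continuous F)
    (hD : Continuous D)
    (hderiv : ∀ Y i j, HasLineDerivAt ℝ (fun Z => F Z i j) (D Y i j) Y (Matrix.single i j 1))
    (hF_mem : EntrywiseMemLp (fun ω => F (X ω)) 2 P)
    (hD_mem : EntrywiseMemLp (fun ω => D (X ω)) 1 P) :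
    ∫ ω, ((X ω - M)ᵀ * F (X ω)).trace ∂P = ∫ ω, ∑ i, ∑ j, D (X ω) i j ∂P := by
  have hcentered : EntrywiseMemLp (fun ω => X ω - M) 2 P :=
    (hX.entrywiseMemLp (by simp)).sub (.const M)
  have hterm (i : Fin n) (j : Fin p) :
      Integrable (fun ω => (X ω i j - M i j) * F (X ω) i j) P :=
    (hcentered i j).integrable_mul (hF_mem i j)
  have htrace (ω : Ω) : ((X ω - M)ᵀ * F (X ω)).trace =
      ∑ i, ∑ j, (X ω i j - M i j) * F (X ω) i j := by
    rw [Finset.sum_comm]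
    rfl
  have hD_int (i : Fin n) (j : Fin p) : Integrable (fun ω => D (X ω) i j) P :=
    memLp_one_iff_integrable.1 (hD_mem i j)
  simp only [htrace]
  rw [integral_finsetSum _ fun i _ => integrable_finsetSum _ fun j _ => hterm i j,
    integral_finsetSum _ fun i _ => integrable_finsetSum _ fun j _ => hD_int i j]
  refine Finset.sum_congr rfl fun i _ => ?_
  rw [integral_finsetSum _ fun j _ => hterm i j, integral_finsetSum _ fun j _ => hD_int i j]
  exact Finset.sum_congr rfl fun j _ => hX.integral_sub_mul i j (hF.matrix_elem i j)
    (hD.matrix_elem i j) (fun Y => hderiv Y i j) (hF_mem i j) (hD_int i j)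

end IsGaussianMatrix

section QuadraticLoss

variable {n p : ℕ}

theorem quadraticLoss_nonneg {Q : Matrix (Fin p) (Fin p) ℝ} (hQ : Q.PosSemidef)
    (T Y : Matrix (Fin n) (Fin p) ℝ) : 0 ≤ quadraticLoss Q T Y := by
  simpa only [quadraticLoss, Matrix.conjTranspose_eq_transpose_of_trivial] using
    (hQ.mul_mul_conjTranspose_same (Y - T)).trace_nonneg

theorem linearEstimator_one (X : Matrix (Fin n) (Fin p) ℝ) : linearEstimator 1 X = X :=
  Matrix.mul_one X

theorem quadraticLoss_self (Q : Matrix (Fin p) (Fin p) ℝ) (M : Matrix (Fin n) (Fin p) ℝ) :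
    quadraticLoss Q M M = 0 := by
  rw [quadraticLoss, sub_self, Matrix.zero_mul, Matrix.zero_mul, Matrix.trace_zero]

theorem quadraticLoss_sub_smul {Q : Matrix (Fin p) (Fin p) ℝ} (hQ : Qᵀ = Q)
    (M Y W : Matrix (Fin n) (Fin p) ℝ) (c : ℝ) :
    quadraticLoss Q M (Y - c • W) =
      quadraticLoss Q M Y - 2 * c * ((Y - M)ᵀ * (W * Q)).trace + c ^ 2 * (W * Q * Wᵀ).trace := by
  have hcross : ((Y - M) * Q * Wᵀ).trace = ((Y - M)ᵀ * (W * Q)).trace := by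
    rw [← Matrix.trace_transpose, Matrix.transpose_mul, Matrix.transpose_mul, hQ,
      Matrix.transpose_transpose, ← Matrix.mul_assoc, Matrix.trace_mul_comm]
  have hcross' : (W * Q * (Y - M)ᵀ).trace = ((Y - M)ᵀ * (W * Q)).trace := Matrix.trace_mul_comm _ _
  rw [quadraticLoss, quadraticLoss, sub_right_comm]
  generalize Y - M = Z at hcross hcross' ⊢
  simp only [Matrix.transpose_sub, Matrix.transpose_smul, Matrix.sub_mul, Matrix.mul_sub,
    Matrix.smul_mul, Matrix.mul_smul, Matrix.trace_sub, Matrix.trace_smul, smul_eq_mul, hcross,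
    hcross']
  ring

theorem quadraticLoss_linearEstimator (Q C : Matrix (Fin p) (Fin p) ℝ)
    (T M X : Matrix (Fin n) (Fin p) ℝ) :
    quadraticLoss Q T (linearEstimator C X) =
      ((X - M)ᵀ * (X * (C * Q * Cᵀ) + ((M * C - T) * (Q + Qᵀ) * Cᵀ - M * (C * Q * Cᵀ)))).trace
        + quadraticLoss Q T (linearEstimator C M) := by
  have hsplit : X * C - T = (X - M) * C + (M * C - T) := by
    rw [Matrix.sub_mul]
    abel
  have hcenter : X * (C * Q * Cᵀ) + ((M * C - T) * (Q + Qᵀ) * Cᵀ - M * (C * Q * Cᵀ)) =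
      (X - M) * (C * Q * Cᵀ) + (M * C - T) * (Q + Qᵀ) * Cᵀ := by
    rw [Matrix.sub_mul X]
    abel
  rw [quadraticLoss, quadraticLoss, linearEstimator, linearEstimator, hsplit, hcenter]
  generalize X - M = Z
  generalize M * C - T = D
  have hsq : (Z * C * Q * (Z * C)ᵀ).trace = (Zᵀ * (Z * (C * Q * Cᵀ))).trace := by
    rw [Matrix.trace_mul_comm Zᵀ, Matrix.transpose_mul]
    simp only [Matrix.mul_assoc]
  have hcross : (D * Q * (Z * C)ᵀ).trace = (Zᵀ * (D * Q * Cᵀ)).trace := by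
    rw [Matrix.trace_mul_comm Zᵀ, Matrix.transpose_mul]
    simp only [Matrix.mul_assoc]
  have hcross' : (Z * C * Q * Dᵀ).trace = (Zᵀ * (D * Qᵀ * Cᵀ)).trace := by
    rw [← Matrix.trace_transpose, Matrix.trace_mul_comm Zᵀ]
    simp only [Matrix.transpose_mul, Matrix.transpose_transpose, Matrix.mul_assoc]
  rw [Matrix.transpose_add]
  simp only [Matrix.add_mul, Matrix.mul_add, Matrix.trace_add, hsq, hcross, hcross']
  ring

end QuadraticLoss

namespace IsGaussianMatrix

variable {Ω : Type*} [MeasurableSpace Ω] {P : Measure Ω} [IsProbabilityMeasure P] {n p : ℕ}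
  {X : Ω → Matrix (Fin n) (Fin p) ℝ} {M : Matrix (Fin n) (Fin p) ℝ}

theorem integral_trace_sub_transpose_mul_affine (hX : IsGaussianMatrix X M P)
    (A : Matrix (Fin p) (Fin p) ℝ) (B : Matrix (Fin n) (Fin p) ℝ) :
    ∫ ω, ((X ω - M)ᵀ * (X ω * A + B)).trace ∂P = n * A.trace := by
  have hderiv (Y : Matrix (Fin n) (Fin p) ℝ) (i : Fin n) (j : Fin p) :
      HasLineDerivAt ℝ (fun Z => (Z * A + B) i j) (A j j) Y (Matrix.single i j 1) := by
    refine hasLineDerivAt_of_eq_add_mul (r := fun _ => A j j) continuousAt_const fun t => ?_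
    simp only [Matrix.add_mul, Matrix.add_apply, Matrix.smul_mul, Matrix.smul_apply,
      Matrix.single_mul_apply_same, one_mul, smul_eq_mul]
    ring
  rw [hX.integral_trace_sub_transpose_mul (F := fun Y => Y * A + B)
    (D := fun _ => Matrix.of fun _ j => A j j) (by fun_prop) continuous_const hderiv
    (((hX.entrywiseMemLp (by simp)).mul_const A).add (.const B)) (.const _)]
  simp only [Matrix.of_apply, integral_const, probReal_univ, Finset.sum_const, Finset.card_univ,
    Fintype.card_fin, nsmul_eq_mul, one_smul, Matrix.trace, Matrix.diag_apply]

theorem integrable_quadraticLoss_linearEstimator (hX : IsGaussianMatrix X M P)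
    (Q C : Matrix (Fin p) (Fin p) ℝ) (T : Matrix (Fin n) (Fin p) ℝ) :
    Integrable (fun ω => quadraticLoss Q T (linearEstimator C (X ω))) P :=
  ((hX.entrywiseMemLp (by simp)).mul_const C).integrable_quadraticLoss Q T

theorem integral_quadraticLoss_linearEstimator (hX : IsGaussianMatrix X M P)
    (Q C : Matrix (Fin p) (Fin p) ℝ) (T : Matrix (Fin n) (Fin p) ℝ) :
    ∫ ω, quadraticLoss Q T (linearEstimator C (X ω)) ∂P =
      n * (C * Q * Cᵀ).trace + quadraticLoss Q T (linearEstimator C M) := by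
  have hmem : EntrywiseMemLp X 2 P := hX.entrywiseMemLp (by simp)
  have hint := (hmem.sub (.const M)).integrable_trace_transpose_mul
    ((hmem.mul_const (C * Q * Cᵀ)).add
      (.const ((M * C - T) * (Q + Qᵀ) * Cᵀ - M * (C * Q * Cᵀ))))
  rw [integral_congr_ae (.of_forall fun ω => quadraticLoss_linearEstimator Q C T M (X ω)),
    integral_add hint (integrable_const _), hX.integral_trace_sub_transpose_mul_affine,
    integral_const, probReal_univ, one_smul]

end IsGaussianMatrix

section RidgeShrinkage

/-- The Efron–Morris estimator with a general constant `c`, and with `(Xᵀ X)⁻¹` regularized to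
`(Xᵀ X + ε I)⁻¹`. For `ε > 0` it is a smooth function of `X`, so that Stein's identity applies. -/
noncomputable def ridgeShrinkage {m k : Type*} [Fintype m] [Fintype k] [DecidableEq k] (c ε : ℝ)
    (X : Matrix m k ℝ) : Matrix m k ℝ :=
  X * (1 - c • ridgeInv ε X)

variable {n p : ℕ}

theorem efronMorris_eq_ridgeShrinkage (X : Matrix (Fin n) (Fin p) ℝ) :
    efronMorris X = ridgeShrinkage ((n : ℝ) - p - 1) 0 X := by
  rw [efronMorris, ridgeShrinkage, ridgeInv_zero]

theorem oracleCoeff_eq_one_sub_smul_ridgeInv (hn : 0 < n) (M : Matrix (Fin n) (Fin p) ℝ) :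
    oracleCoeff M = 1 - (n : ℝ) • ridgeInv (n : ℝ) M :=
  ridgeInv_mul_gram (Nat.cast_pos.2 hn) M

theorem continuousAt_quadraticLoss_ridgeShrinkage {ε : ℝ} {X : Matrix (Fin n) (Fin p) ℝ}
    (hX : IsUnit (Xᵀ * X + ε • (1 : Matrix (Fin p) (Fin p) ℝ))) (Q : Matrix (Fin p) (Fin p) ℝ)
    (T : Matrix (Fin n) (Fin p) ℝ) (c : ℝ) :
    ContinuousAt (fun δ => quadraticLoss Q T (ridgeShrinkage c δ X)) ε :=
  (show Continuous fun G : Matrix (Fin p) (Fin p) ℝ => quadraticLoss Q T (X * (1 - c • G)) by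
    unfold quadraticLoss
    fun_prop).continuousAt.comp (continuousAt_ridgeInv_left hX)

theorem quadraticLoss_ridgeShrinkage_le {ε : ℝ} (hε : 0 < ε) {Q : Matrix (Fin p) (Fin p) ℝ}
    (hQ : Q.PosSemidef) (M X : Matrix (Fin n) (Fin p) ℝ) (c : ℝ) :
    quadraticLoss Q M (ridgeShrinkage c ε X) ≤
      quadraticLoss Q M X - 2 * c * ((X - M)ᵀ * (X * ridgeInv ε X * Q)).trace
        + c ^ 2 * (Q * ridgeInv ε X).trace := by
  rw [ridgeShrinkage, Matrix.mul_sub, Matrix.mul_one, Matrix.mul_smul,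
    quadraticLoss_sub_smul (transpose_eq_self_of_posSemidef hQ)]
  gcongr
  exact trace_mul_ridgeInv_mul_transpose_le hε hQ X

theorem quadraticLoss_zero (Q : Matrix (Fin p) (Fin p) ℝ) (X : Matrix (Fin n) (Fin p) ℝ) :
    quadraticLoss Q 0 X = (Q * (Xᵀ * X)).trace := by
  rw [quadraticLoss, sub_zero, Matrix.mul_assoc, Matrix.trace_mul_comm, Matrix.mul_assoc]

theorem trace_mul_ridgeInv_ge_tangent {ε : ℝ} (hε : 0 < ε) {Q B : Matrix (Fin p) (Fin p) ℝ}
    (hQ : Q.PosSemidef) (hB : Bᵀ = B) (X : Matrix (Fin n) (Fin p) ℝ) :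
    2 * (Q * B).trace - (quadraticLoss (B * Q * B) 0 X + ε * (B * Q * B).trace) ≤
      (Q * ridgeInv ε X).trace := by
  have htangent := trace_mul_nonneg_of_posSemidef hQ
    (posSemidef_inv_sub_tangent (posDef_gram_add_smul_one hε X) hB)
  have hgram : (Q * (B * (Xᵀ * X + ε • (1 : Matrix (Fin p) (Fin p) ℝ)) * B)).trace =
      quadraticLoss (B * Q * B) 0 X + ε * (B * Q * B).trace := by
    rw [← Matrix.mul_assoc Q, Matrix.trace_mul_comm, ← Matrix.mul_assoc Q, ← Matrix.mul_assoc B,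
      ← Matrix.mul_assoc B, Matrix.mul_add, Matrix.trace_add, Matrix.mul_smul, Matrix.mul_one,
      Matrix.trace_smul, smul_eq_mul, quadraticLoss_zero]
  rw [← ridgeInv, Matrix.mul_sub, Matrix.mul_sub, Matrix.mul_smul, Matrix.trace_sub,
    Matrix.trace_sub, Matrix.trace_smul, smul_eq_mul, hgram] at htangent
  linarith

theorem quadraticLoss_ridgeInv_zero {δ : ℝ} (hδ : 0 < δ) (Q : Matrix (Fin p) (Fin p) ℝ)
    (M : Matrix (Fin n) (Fin p) ℝ) :
    quadraticLoss (ridgeInv δ M * Q * ridgeInv δ M) 0 M =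
      (Q * ridgeInv δ M).trace - δ * (ridgeInv δ M * Q * ridgeInv δ M).trace := by
  rw [quadraticLoss_zero, Matrix.mul_assoc, ridgeInv_mul_gram hδ, Matrix.mul_sub, Matrix.mul_one,
    Matrix.mul_smul, Matrix.trace_sub, Matrix.trace_smul, smul_eq_mul, Matrix.trace_mul_comm]

end RidgeShrinkage

theorem integrable_and_integral_le_of_tendsto {Ω : Type*} [MeasurableSpace Ω] {P : Measure Ω}
    {f : ℕ → Ω → ℝ} {g : Ω → ℝ} {b : ℕ → ℝ} {B : ℝ} (hf : ∀ m, Integrable (f m) P)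
    (hf_nonneg : ∀ m, 0 ≤ f m) (hlim : ∀ᵐ ω ∂P, Tendsto (fun m => f m ω) atTop (𝓝 (g ω)))
    (hb : ∀ m, ∫ ω, f m ω ∂P ≤ b m) (hbB : Tendsto b atTop (𝓝 B)) :
    Integrable g P ∧ ∫ ω, g ω ∂P ≤ B := by
  have hg_meas : AEStronglyMeasurable g P :=
    aestronglyMeasurable_of_tendsto_ae atTop (fun m => (hf m).aestronglyMeasurable) hlim
  have hg_nonneg : 0 ≤ᵐ[P] g := by
    filter_upwards [hlim] with ω hω
    exact ge_of_tendsto' hω fun m => hf_nonneg m ω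
  have hB : 0 ≤ B := ge_of_tendsto' hbB fun m => (integral_nonneg (hf_nonneg m)).trans (hb m)
  have hfatou : ∫⁻ ω, ENNReal.ofReal (g ω) ∂P ≤ ENNReal.ofReal B := by
    calc ∫⁻ ω, ENNReal.ofReal (g ω) ∂P
        = ∫⁻ ω, liminf (fun m => ENNReal.ofReal (f m ω)) atTop ∂P := by
          refine lintegral_congr_ae ?_
          filter_upwards [hlim] with ω hω
          exact (ENNReal.tendsto_ofReal hω).liminf_eq.symm
      _ ≤ liminf (fun m => ∫⁻ ω, ENNReal.ofReal (f m ω) ∂P) atTop :=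
          lintegral_liminf_le' fun m => (hf m).aemeasurable.ennreal_ofReal
      _ ≤ liminf (fun m => ENNReal.ofReal (b m)) atTop := by
          refine liminf_le_liminf (.of_forall fun m => ?_)
          rw [← ofReal_integral_eq_lintegral_ofReal (hf m) (.of_forall (hf_nonneg m))]
          exact ENNReal.ofReal_le_ofReal (hb m)
      _ = ENNReal.ofReal B := (ENNReal.tendsto_ofReal hbB).liminf_eq
  refine ⟨(lintegral_ofReal_ne_top_iff_integrable hg_meas hg_nonneg).1
    (hfatou.trans_lt ENNReal.ofReal_lt_top).ne, ?_⟩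
  rw [integral_eq_lintegral_of_nonneg_ae hg_nonneg hg_meas]
  exact ENNReal.toReal_le_of_le_ofReal hB hfatou

namespace IsGaussianMatrix

variable {Ω : Type*} [MeasurableSpace Ω] {P : Measure Ω} [IsProbabilityMeasure P] {n p : ℕ}
  {X : Ω → Matrix (Fin n) (Fin p) ℝ} {M : Matrix (Fin n) (Fin p) ℝ} {ε : ℝ}
  {Q : Matrix (Fin p) (Fin p) ℝ}

theorem entrywiseMemLp_ridgeInv (hX : IsGaussianMatrix X M P) (hε : 0 < ε) {q : ℝ≥0∞} :
    EntrywiseMemLp (fun ω => ridgeInv ε (X ω)) q P := fun i j =>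
  .of_bound (hX.aestronglyMeasurable_comp ((continuous_ridgeInv hε).matrix_elem i j)) ε⁻¹
    (.of_forall fun ω => abs_ridgeInv_apply_le hε (X ω) i j)

theorem entrywiseMemLp_mul_ridgeInv_mul (hX : IsGaussianMatrix X M P) (hε : 0 < ε)
    (Q : Matrix (Fin p) (Fin p) ℝ) :
    EntrywiseMemLp (fun ω => X ω * ridgeInv ε (X ω) * Q) 2 P :=
  ((hX.entrywiseMemLp (q := 2) (by simp)).mul
    (hX.entrywiseMemLp_ridgeInv (q := ∞) hε)).mul_const Q

theorem entrywiseMemLp_ridgeEntryDeriv (hX : IsGaussianMatrix X M P) (hε : 0 < ε)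
    (Q : Matrix (Fin p) (Fin p) ℝ) :
    EntrywiseMemLp (fun ω => ridgeEntryDeriv ε Q (X ω)) 1 P := by
  intro i j
  have hmem : EntrywiseMemLp X 2 P := hX.entrywiseMemLp (by simp)
  have hG : EntrywiseMemLp (fun ω => ridgeInv ε (X ω)) ∞ P := hX.entrywiseMemLp_ridgeInv hε
  have hXG : EntrywiseMemLp (fun ω => X ω * ridgeInv ε (X ω)) 2 P := hmem.mul hG
  have hGQ := hG.mul_const Q
  have hleverage : EntrywiseMemLp (fun ω => X ω * ridgeInv ε (X ω) * (X ω)ᵀ) 1 P :=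
    hXG.mul hmem.transpose
  exact (((hGQ j j).mono_exponent le_top).sub ((hXG.mul_const Q i j).mul' (hXG i j))).sub
    ((hGQ j j).mul' (hleverage i i))

theorem integrable_trace_mul_ridgeInv (hX : IsGaussianMatrix X M P) (hε : 0 < ε)
    (Q : Matrix (Fin p) (Fin p) ℝ) : Integrable (fun ω => (Q * ridgeInv ε (X ω)).trace) P :=
  ((EntrywiseMemLp.const (q := 1) Q).mul
    (hX.entrywiseMemLp_ridgeInv (q := ∞) hε)).integrable_trace

theorem integrable_quadraticLoss_ridgeShrinkage (hX : IsGaussianMatrix X M P) (hε : 0 < ε)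
    (Q : Matrix (Fin p) (Fin p) ℝ) (T : Matrix (Fin n) (Fin p) ℝ) (c : ℝ) :
    Integrable (fun ω => quadraticLoss Q T (ridgeShrinkage c ε (X ω))) P :=
  ((hX.entrywiseMemLp (q := 2) (by simp)).mul ((EntrywiseMemLp.const 1).sub
    ((hX.entrywiseMemLp_ridgeInv (q := ∞) hε).const_smul c))).integrable_quadraticLoss Q T

theorem integral_quadraticLoss_self (hX : IsGaussianMatrix X M P)
    (Q : Matrix (Fin p) (Fin p) ℝ) : ∫ ω, quadraticLoss Q M (X ω) ∂P = n * Q.trace := by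
  simpa only [linearEstimator_one, quadraticLoss_self, Matrix.one_mul, Matrix.transpose_one,
    Matrix.mul_one, add_zero] using hX.integral_quadraticLoss_linearEstimator Q 1 M

theorem integral_trace_mul_ridgeInv_le_integral_divergence (hX : IsGaussianMatrix X M P)
    (hε : 0 < ε) (hQ : Q.PosSemidef) :
    ((n : ℝ) - p - 1) * ∫ ω, (Q * ridgeInv ε (X ω)).trace ∂P ≤
      ∫ ω, ((X ω - M)ᵀ * (X ω * ridgeInv ε (X ω) * Q)).trace ∂P := by
  have hderiv_mem := hX.entrywiseMemLp_ridgeEntryDeriv hε Q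
  rw [hX.integral_trace_sub_transpose_mul (F := fun Y => Y * ridgeInv ε Y * Q)
    (by have := continuous_ridgeInv (m := Fin n) (k := Fin p) hε; fun_prop)
    (continuous_ridgeEntryDeriv hε Q) (hasLineDerivAt_ridgeEntryDeriv hε Q)
    (hX.entrywiseMemLp_mul_ridgeInv_mul hε Q) hderiv_mem, ← integral_const_mul]
  refine integral_mono ((hX.integrable_trace_mul_ridgeInv hε Q).const_mul _)
    (integrable_finsetSum _ fun i _ => integrable_finsetSum _ fun j _ =>
      memLp_one_iff_integrable.1 (hderiv_mem i j)) fun ω => ?_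
  simpa only [Fintype.card_fin] using trace_mul_ridgeInv_le_divergence hε hQ (X ω)

theorem integral_quadraticLoss_ridgeShrinkage_le (hX : IsGaussianMatrix X M P) (hε : 0 < ε)
    (hQ : Q.PosSemidef) {c : ℝ} (hc : 0 ≤ c) :
    ∫ ω, quadraticLoss Q M (ridgeShrinkage c ε (X ω)) ∂P ≤
      n * Q.trace - c * (2 * ((n : ℝ) - p - 1) - c) * ∫ ω, (Q * ridgeInv ε (X ω)).trace ∂P := by
  have hmem : EntrywiseMemLp X 2 P := hX.entrywiseMemLp (by simp)
  have hloss := hmem.integrable_quadraticLoss Q M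
  have hcross := ((hmem.sub (.const M)).integrable_trace_transpose_mul
    (hX.entrywiseMemLp_mul_ridgeInv_mul hε Q)).const_mul (2 * c)
  have htrace := (hX.integrable_trace_mul_ridgeInv hε Q).const_mul (c ^ 2)
  have hbound := integral_mono (hX.integrable_quadraticLoss_ridgeShrinkage hε Q M c)
    ((hloss.sub hcross).add htrace) fun ω => quadraticLoss_ridgeShrinkage_le hε hQ M (X ω) c
  have hexpand := integral_add (hloss.sub hcross) htrace
  simp only [Pi.add_apply, Pi.sub_apply] at hbound hexpand
  rw [hexpand, integral_sub hloss hcross, integral_const_mul, integral_const_mul,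
    hX.integral_quadraticLoss_self] at hbound
  nlinarith [mul_le_mul_of_nonneg_left
    (hX.integral_trace_mul_ridgeInv_le_integral_divergence hε hQ) hc]

theorem ae_isUnit_gram (hX : IsGaussianMatrix X M P) (hnp : p + 1 < n) :
    ∀ᵐ ω ∂P, IsUnit ((X ω)ᵀ * X ω) := by
  set c : ℝ := (n : ℝ) - p - 1 with hc_def
  have hc : 0 < c := by
    have : (p : ℝ) + 1 < n := by exact_mod_cast hnp
    linarith
  have hmean {ε : ℝ} (hε : 0 < ε) : ∫ ω, (ridgeInv ε (X ω)).trace ∂P ≤ n * p / c ^ 2 := by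
    have hrisk := hX.integral_quadraticLoss_ridgeShrinkage_le hε Matrix.PosSemidef.one hc.le
    have hnonneg : 0 ≤ ∫ ω, quadraticLoss 1 M (ridgeShrinkage c ε (X ω)) ∂P :=
      integral_nonneg fun ω => quadraticLoss_nonneg Matrix.PosSemidef.one _ _
    simp only [Matrix.one_mul, Matrix.trace_one, Fintype.card_fin, ← hc_def] at hrisk
    rw [le_div_iff₀ (by positivity)]
    linarith
  have hprob {ε : ℝ} (hε : 0 < ε) : P.real {ω | ¬IsUnit ((X ω)ᵀ * X ω)} ≤ ε * (n * p / c ^ 2) := by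
    have hmarkov := mul_meas_ge_le_integral_of_nonneg
      (.of_forall fun ω => (posSemidef_ridgeInv hε (X ω)).trace_nonneg)
      (hX.entrywiseMemLp_ridgeInv hε).integrable_trace ε⁻¹
    have hmono : P.real {ω | ¬IsUnit ((X ω)ᵀ * X ω)} ≤
        P.real {ω | ε⁻¹ ≤ (ridgeInv ε (X ω)).trace} :=
      measureReal_mono fun ω hω => inv_le_trace_ridgeInv hε hω
    rw [inv_mul_le_iff₀ hε] at hmarkov
    exact hmono.trans (hmarkov.trans (by gcongr; exact hmean hε))
  have hlim : Tendsto (fun ε : ℝ => ε * (n * p / c ^ 2)) (𝓝[>] 0) (𝓝 0) :=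
    ((continuous_mul_const (n * p / c ^ 2)).tendsto' 0 0 (zero_mul _)).mono_left nhdsWithin_le_nhds
  have hzero : P.real {ω | ¬IsUnit ((X ω)ᵀ * X ω)} ≤ 0 :=
    ge_of_tendsto hlim (by filter_upwards [self_mem_nhdsWithin] with ε hε using hprob hε)
  exact (measureReal_eq_zero_iff (measure_ne_top _ _)).1 (hzero.antisymm measureReal_nonneg)

/- Jensen's inequality for `A ↦ A⁻¹`, since `E (Xᵀ X + ε I) = Mᵀ M + (n + ε) I`: take `B` in the
tangent bound to be the inverse of this mean. -/
theorem trace_mul_ridgeInv_le_integral (hX : IsGaussianMatrix X M P) (hε : 0 < ε)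
    (hQ : Q.PosSemidef) :
    (Q * ridgeInv (n + ε) M).trace ≤ ∫ ω, (Q * ridgeInv ε (X ω)).trace ∂P := by
  have hδ : 0 < n + ε := by positivity
  set B := ridgeInv (n + ε) M
  have hloss : Integrable (fun ω => quadraticLoss (B * Q * B) 0 (X ω)) P :=
    EntrywiseMemLp.integrable_quadraticLoss (hX.entrywiseMemLp (by simp)) _ _
  have hmean : ∫ ω, quadraticLoss (B * Q * B) 0 (X ω) ∂P =
      n * (B * Q * B).trace + quadraticLoss (B * Q * B) 0 M := by
    simpa only [linearEstimator_one, Matrix.one_mul, Matrix.transpose_one, Matrix.mul_one] using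
      hX.integral_quadraticLoss_linearEstimator (B * Q * B) 1 0
  have hbound := integral_mono
    ((integrable_const (2 * (Q * B).trace)).sub (hloss.add (integrable_const _)))
    (hX.integrable_trace_mul_ridgeInv hε Q)
    fun ω => trace_mul_ridgeInv_ge_tangent hε hQ (transpose_ridgeInv hδ M) (X ω)
  have hexpand := integral_sub (integrable_const (μ := P) (2 * (Q * B).trace))
    (hloss.add (integrable_const (ε * (B * Q * B).trace)))
  simp only [Pi.add_apply, Pi.sub_apply] at hbound hexpand
  rw [hexpand, integral_add hloss (integrable_const _), hmean, integral_const, integral_const,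
    probReal_univ, one_smul, one_smul, quadraticLoss_ridgeInv_zero hδ] at hbound
  linarith

theorem integral_quadraticLoss_oracle (hX : IsGaussianMatrix X M P) (hn : 0 < n)
    (hQ : Qᵀ = Q) :
    ∫ ω, quadraticLoss Q M (linearEstimator (oracleCoeff M) (X ω)) ∂P =
      n * Q.trace - n ^ 2 * (Q * ridgeInv (n : ℝ) M).trace := by
  have hn' : (0 : ℝ) < n := Nat.cast_pos.2 hn
  rw [hX.integral_quadraticLoss_linearEstimator, oracleCoeff_eq_one_sub_smul_ridgeInv hn]
  set G := ridgeInv (n : ℝ) M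
  have hvar : ((1 - (n : ℝ) • G) * Q * (1 - (n : ℝ) • G)ᵀ).trace =
      Q.trace - 2 * n * (Q * G).trace + n ^ 2 * (G * Q * G).trace := by
    rw [Matrix.transpose_sub, Matrix.transpose_one, Matrix.transpose_smul,
      transpose_ridgeInv hn']
    simp only [Matrix.sub_mul, Matrix.mul_sub, Matrix.one_mul, Matrix.mul_one, Matrix.smul_mul,
      Matrix.mul_smul, Matrix.trace_sub, Matrix.trace_smul, smul_eq_mul, Matrix.trace_mul_comm G Q]
    ring
  have hbias : quadraticLoss Q M (linearEstimator (1 - (n : ℝ) • G) M) =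
      n ^ 2 * ((Q * G).trace - n * (G * Q * G).trace) := by
    rw [linearEstimator, Matrix.mul_sub, Matrix.mul_one, Matrix.mul_smul,
      quadraticLoss_sub_smul hQ, quadraticLoss_self, sub_self, trace_mul_ridgeInv_mul_transpose hn',
      Matrix.transpose_zero, Matrix.zero_mul, Matrix.trace_zero]
    ring
  rw [hvar, hbias]
  ring

theorem integrable_and_integral_quadraticLoss_efronMorris_le (hX : IsGaussianMatrix X M P)
    (hnp : p + 1 < n) (hQ : Q.PosSemidef) :
    Integrable (fun ω => quadraticLoss Q M (efronMorris (X ω))) P ∧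
      ∫ ω, quadraticLoss Q M (efronMorris (X ω)) ∂P ≤
        n * Q.trace - ((n : ℝ) - p - 1) ^ 2 * (Q * ridgeInv (n : ℝ) M).trace := by
  set c : ℝ := (n : ℝ) - p - 1
  have hc : 0 ≤ c := by
    have : (p : ℝ) + 1 < n := by exact_mod_cast hnp
    linarith
  have hn : (0 : ℝ) < n := Nat.cast_pos.2 (by omega)
  let ε (m : ℕ) : ℝ := 1 / ((m : ℝ) + 1)
  have hε (m : ℕ) : 0 < ε m := Nat.one_div_pos_of_nat
  have hε_lim : Tendsto ε atTop (𝓝 0) := tendsto_one_div_add_atTop_nhds_zero_nat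
  refine integrable_and_integral_le_of_tendsto
    (f := fun m ω => quadraticLoss Q M (ridgeShrinkage c (ε m) (X ω)))
    (b := fun m => n * Q.trace - c ^ 2 * (Q * ridgeInv (n + ε m) M).trace)
    (fun m => hX.integrable_quadraticLoss_ridgeShrinkage (hε m) Q M c)
    (fun m ω => quadraticLoss_nonneg hQ _ _) ?_ (fun m => ?_) ?_
  · filter_upwards [hX.ae_isUnit_gram hnp] with ω hω
    rw [efronMorris_eq_ridgeShrinkage]
    exact (continuousAt_quadraticLoss_ridgeShrinkage (by simpa using hω) Q M c).tendsto.comp hε_lim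
  · refine (hX.integral_quadraticLoss_ridgeShrinkage_le (hε m) hQ hc).trans ?_
    have hjensen := hX.trace_mul_ridgeInv_le_integral (hε m) hQ
    nlinarith [mul_le_mul_of_nonneg_left hjensen (sq_nonneg c)]
  · have hridge : Tendsto (fun m => ridgeInv (n + ε m) M) atTop (𝓝 (ridgeInv (n : ℝ) M)) :=
      (continuousAt_ridgeInv_left (isUnit_gram_add_smul_one hn M)).tendsto.comp
        (by simpa using hε_lim.const_add (n : ℝ))
    have hcont : Continuous fun G : Matrix (Fin p) (Fin p) ℝ =>
        n * Q.trace - c ^ 2 * (Q * G).trace := by fun_prop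
    exact (hcont.tendsto _).comp hridge

end IsGaussianMatrix

theorem mainTheorem4_general {Ω : Type*} [MeasurableSpace Ω] (P : Measure Ω)
    [IsProbabilityMeasure P] {n p : ℕ} (hnp : p + 1 < n) (M : Matrix (Fin n) (Fin p) ℝ)
    (X : Ω → Matrix (Fin n) (Fin p) ℝ) (hX : IsGaussianMatrix X M P)
    (Q : Matrix (Fin p) (Fin p) ℝ) (hQ : Q.PosSemidef) :
    Integrable (fun ω => quadraticLoss Q M (efronMorris (X ω))) P ∧
    Integrable (fun ω => quadraticLoss Q M (linearEstimator (oracleCoeff M) (X ω))) P ∧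
    ∫ ω, quadraticLoss Q M (efronMorris (X ω)) ∂P ≤
      ∫ ω, quadraticLoss Q M (linearEstimator (oracleCoeff M) (X ω)) ∂P
        + 2 * ((p : ℝ) + 1) * Q.trace := by
  have hn : 0 < n := by omega
  have hn' : (0 : ℝ) < n := Nat.cast_pos.2 hn
  obtain ⟨hint, hrisk⟩ := hX.integrable_and_integral_quadraticLoss_efronMorris_le hnp hQ
  refine ⟨hint, hX.integrable_quadraticLoss_linearEstimator Q (oracleCoeff M) M,
    hrisk.trans ?_⟩
  rw [hX.integral_quadraticLoss_oracle hn (transpose_eq_self_of_posSemidef hQ)]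
  have hnonneg := trace_mul_ridgeInv_nonneg hn' hQ M
  have hle := mul_trace_mul_ridgeInv_le_trace hn' hQ M
  nlinarith [mul_nonneg (sq_nonneg ((p : ℝ) + 1)) hnonneg,
    mul_le_mul_of_nonneg_left hle (by positivity : 0 ≤ 2 * ((p : ℝ) + 1))]

theorem mainTheorem4 {Ω : Type*} [MeasurableSpace Ω] (P : Measure Ω) [IsProbabilityMeasure P]
    {n p : ℕ} (hnp : p + 1 < n) (M : Matrix (Fin n) (Fin p) ℝ)
    (X : Ω → Matrix (Fin n) (Fin p) ℝ) (hX : IsGaussianMatrix X M P)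
    (Q : Matrix (Fin p) (Fin p) ℝ) (hQ : Q.PosDef) :
    Integrable (fun ω => quadraticLoss Q M (efronMorris (X ω))) P ∧
    Integrable (fun ω => quadraticLoss Q M (linearEstimator (oracleCoeff M) (X ω))) P ∧
    ∫ ω, quadraticLoss Q M (efronMorris (X ω)) ∂P ≤
      ∫ ω, quadraticLoss Q M (linearEstimator (oracleCoeff M) (X ω)) ∂P
        + 2 * ((p : ℝ) + 1) * Q.trace :=
  mainTheorem4_general P hnp M X hX Q hQ.posSemidef
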